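/- Let $m\ge 0$, $N\ge 1$, let $\|\cdot\|$ be an arbitrary norm on $\mathbb{R}^m$ with dual norm $\|z\|_*=\sup_{\|\xi\|\le 1}\langle z,\xi\rangle$, and let $\Xi=\{\xi\in\mathbb{R}^m: C\xi\le d\}$ be a (possibly unbounded) polytope, where $C$ is a real matrix and $d$ a real vector. Let $\widehat\xi_1,\dots,\widehat\xi_N\in\Xi$, let $\widehat{\mathbb P}_N=\frac1N\sum_{i=1}^N\delta_{\widehat\xi_i}$, and let $\varepsilon\ge 0$. Let $\mathcal M(\Xi)$ be the set of Borel probability distributions $\mathbb Q$ on $\mathbb{R}^m$ supported on $\Xi$ with $\int\|\xi\|\,\mathbb Q(d\xi)<\infty$, let $d_W(\mathbb Q_1,\mathbb Q_2)$ be the infimum of $\int\|\xi_1-\xi_2\|\,\Pi(d\xi_1,d\xi_2)$ over all joint distributions $\Pi$ with marginals $\mathbb Q_1$ and $\mathbb Q_2$, and let $\mathbb B_\varepsilon(\widehat{\mathbb P}_N)=\{\mathbb Q\in\mathcal M(\Xi): d_W(\widehat{\mathbb P}_N,\mathbb Q)\le\varepsilon\}$. Let $A$ be a real matrix with $K$ rows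 $a_1,\dots,a_K\in\mathbb{R}^m$ and let $b\in\mathbb{R}^K$. Vector inequalities are componentwise. (i) Let $\mathcal A=\{\xi\in\mathbb{R}^m: A\xi<b\}$. If $K\ge1$ and, for every $k\le K$, the halfspace $\{\xi:\langle a_k,\xi\rangle\ge b_k\}$ has a nonempty intersection with $\Xi$, then the worst-case probability $\sup_{\mathbb Q\in\mathbb B_\varepsilon(\widehat{\mathbb P}_N)}\mathbb Q[\xi\notin\mathcal A]$ equals $$ \left\{\begin{array}{cll} \inf\limits_{\lambda,s_i,\gamma_{ik},\theta_{ik}} & \lambda\varepsilon+\frac1N\sum_{i=1}^N s_i\\ \text{s.t.} & 1-\theta_{ik}\big(b_k-\langle a_k,\widehat\xi_i\rangle\big)+\langle\gamma_{ik},d-C\widehat\xi_i\rangle\le s_i & \forall i\le N,\ k\le K\\ & \|a_k\theta_{ik}-C^\top\gamma_{ik}\|_*\le\lambda & \forall i\le N,\ k\le K\\ & \gamma_{ik}\ge0,\ \theta_{ik}\ge0 & \forall i\le N,\ k\le K\\ & s_i\ge0 & \forall i\le N. \end{array}\right. $$ (ii) Let $\mathcal A=\{\xi\in\mathbb{R}^m: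 A\xi\le b\}$. If $\mathcal A$ has a nonempty intersection with $\Xi$, then the best-case probability $\sup_{\mathbb Q\in\mathbb B_\varepsilon(\widehat{\mathbb P}_N)}\mathbb Q[\xi\in\mathcal A]$ equals $$ \left\{\begin{array}{cll} \inf\limits_{\lambda,s_i,\gamma_i,\theta_i} & \lambda\varepsilon+\frac1N\sum_{i=1}^N s_i\\ \text{s.t.} & 1+\langle\theta_i,b-A\widehat\xi_i\rangle+\langle\gamma_i,d-C\widehat\xi_i\rangle\le s_i & \forall i\le N\\ & \|A^\top\theta_i+C^\top\gamma_i\|_*\le\lambda & \forall i\le N\\ & \gamma_i\ge0,\ \theta_i\ge0,\ s_i\ge0 & \forall i\le N. \end{array}\right. $$ -/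

import Mathlib

open MeasureTheory Matrix
open scoped ENNReal

namespace WassersteinUQ

noncomputable section

/-- The dual norm `‖z‖_* = sup {⟨z, ξ⟩ : ‖ξ‖ ≤ 1}` of a norm on `ℝ^m`. -/
def dualNorm {m : ℕ} (nrm : Seminorm ℝ (Fin m → ℝ)) (z : Fin m → ℝ) : ℝ :=
  sSup ((fun ξ : Fin m → ℝ => z ⬝ᵥ ξ) '' {ξ | nrm ξ ≤ 1})

/-- The closed polyhedron `{ξ : C ξ ≤ d}` (componentwise inequality). -/
def closedPolytope {m J : ℕ} (C : Matrix (Fin J) (Fin m) ℝ) (d : Fin J → ℝ) :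
    Set (Fin m → ℝ) :=
  {ξ | ∀ j, (C *ᵥ ξ) j ≤ d j}

/-- The open polyhedron `{ξ : A ξ < b}` (componentwise strict inequality). -/
def openPolytope {m K : ℕ} (A : Matrix (Fin K) (Fin m) ℝ) (b : Fin K → ℝ) :
    Set (Fin m → ℝ) :=
  {ξ | ∀ k, (A *ᵥ ξ) k < b k}

/-- The empirical distribution, uniform on the samples `ξ̂_1, …, ξ̂_N`. -/
def empirical {m N : ℕ} (ξhat : Fin N → Fin m → ℝ) : Measure (Fin m → ℝ) :=
  (N : ℝ≥0∞)⁻¹ • ∑ i, Measure.dirac (ξhat i)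

/-- The set of Borel probability distributions supported on `Ξ` with finite first moment. -/
def finiteMoment {m : ℕ} (nrm : Seminorm ℝ (Fin m → ℝ)) (Ξ : Set (Fin m → ℝ)) :
    Set (Measure (Fin m → ℝ)) :=
  {Q | IsProbabilityMeasure Q ∧ Q Ξᶜ = 0 ∧ ∫⁻ ξ, ENNReal.ofReal (nrm ξ) ∂Q < ∞}

/-- The joint distributions with marginals `Q₁` and `Q₂`. -/
def couplings {m : ℕ} (Q₁ Q₂ : Measure (Fin m → ℝ)) :
    Set (Measure ((Fin m → ℝ) × (Fin m → ℝ))) :=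
  {P | P.map Prod.fst = Q₁ ∧ P.map Prod.snd = Q₂}

/-- The (type-1) Wasserstein distance with respect to the given norm. -/
def wasserstein {m : ℕ} (nrm : Seminorm ℝ (Fin m → ℝ)) (Q₁ Q₂ : Measure (Fin m → ℝ)) :
    ℝ≥0∞ :=
  ⨅ P ∈ couplings Q₁ Q₂, ∫⁻ p, ENNReal.ofReal (nrm (p.1 - p.2)) ∂P

/-- The Wasserstein ball of radius `ε` around `P`, within the distributions on `Ξ`. -/
def wassersteinBall {m : ℕ} (nrm : Seminorm ℝ (Fin m → ℝ)) (Ξ : Set (Fin m → ℝ))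
    (P : Measure (Fin m → ℝ)) (ε : ℝ) : Set (Measure (Fin m → ℝ)) :=
  {Q | Q ∈ finiteMoment nrm Ξ ∧ wasserstein nrm P Q ≤ ENNReal.ofReal ε}

/-- The supremum of the probability of the event `S` over the Wasserstein ball of radius `ε`
around the empirical distribution. -/
def supProb {m N : ℕ} (nrm : Seminorm ℝ (Fin m → ℝ)) (Ξ : Set (Fin m → ℝ))
    (ξhat : Fin N → Fin m → ℝ) (ε : ℝ) (S : Set (Fin m → ℝ)) : EReal :=
  ⨆ Q ∈ wassersteinBall nrm Ξ (empirical ξhat) ε, ((Q S : ℝ≥0∞) : EReal)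

/-- The constraints of the program for the worst-case probability. -/
structure WorstFeasible {m N J K : ℕ} (nrm : Seminorm ℝ (Fin m → ℝ))
    (C : Matrix (Fin J) (Fin m) ℝ) (d : Fin J → ℝ)
    (A : Matrix (Fin K) (Fin m) ℝ) (b : Fin K → ℝ) (ξhat : Fin N → Fin m → ℝ)
    (lam : ℝ) (s : Fin N → ℝ) (γ : Fin N → Fin K → Fin J → ℝ) (θ : Fin N → Fin K → ℝ) :
    Prop where
  epigraph : ∀ i k,
    1 - θ i k * (b k - A k ⬝ᵥ ξhat i) + γ i k ⬝ᵥ (d - C *ᵥ ξhat i) ≤ s i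
  slope : ∀ i k, dualNorm nrm (θ i k • A k - Cᵀ *ᵥ γ i k) ≤ lam
  γ_nonneg : ∀ i k j, 0 ≤ γ i k j
  θ_nonneg : ∀ i k, 0 ≤ θ i k
  s_nonneg : ∀ i, 0 ≤ s i

/-- The optimal value of the program for the worst-case probability. -/
def worstValue {m N J K : ℕ} (nrm : Seminorm ℝ (Fin m → ℝ))
    (C : Matrix (Fin J) (Fin m) ℝ) (d : Fin J → ℝ)
    (A : Matrix (Fin K) (Fin m) ℝ) (b : Fin K → ℝ) (ξhat : Fin N → Fin m → ℝ)
    (ε : ℝ) : EReal :=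
  ⨅ (lam : ℝ) (s : Fin N → ℝ) (γ : Fin N → Fin K → Fin J → ℝ) (θ : Fin N → Fin K → ℝ)
    (_ : WorstFeasible nrm C d A b ξhat lam s γ θ),
    ((lam * ε + 1 / (N : ℝ) * ∑ i, s i : ℝ) : EReal)

/-- The constraints of the program for the best-case probability. -/
structure BestFeasible {m N J K : ℕ} (nrm : Seminorm ℝ (Fin m → ℝ))
    (C : Matrix (Fin J) (Fin m) ℝ) (d : Fin J → ℝ)
    (A : Matrix (Fin K) (Fin m) ℝ) (b : Fin K → ℝ) (ξhat : Fin N → Fin m → ℝ)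
    (lam : ℝ) (s : Fin N → ℝ) (γ : Fin N → Fin J → ℝ) (θ : Fin N → Fin K → ℝ) :
    Prop where
  epigraph : ∀ i,
    1 + θ i ⬝ᵥ (b - A *ᵥ ξhat i) + γ i ⬝ᵥ (d - C *ᵥ ξhat i) ≤ s i
  slope : ∀ i, dualNorm nrm (Aᵀ *ᵥ θ i + Cᵀ *ᵥ γ i) ≤ lam
  γ_nonneg : ∀ i j, 0 ≤ γ i j
  θ_nonneg : ∀ i k, 0 ≤ θ i k
  s_nonneg : ∀ i, 0 ≤ s i

/-- The optimal value of the program for the best-case probability. -/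
def bestValue {m N J K : ℕ} (nrm : Seminorm ℝ (Fin m → ℝ))
    (C : Matrix (Fin J) (Fin m) ℝ) (d : Fin J → ℝ)
    (A : Matrix (Fin K) (Fin m) ℝ) (b : Fin K → ℝ) (ξhat : Fin N → Fin m → ℝ)
    (ε : ℝ) : EReal :=
  ⨅ (lam : ℝ) (s : Fin N → ℝ) (γ : Fin N → Fin J → ℝ) (θ : Fin N → Fin K → ℝ)
    (_ : BestFeasible nrm C d A b ξhat lam s γ θ),
    ((lam * ε + 1 / (N : ℝ) * ∑ i, s i : ℝ) : EReal)

end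

end WassersteinUQ

open WassersteinUQ

/-! Let `S` be the event and `Ξ` the support set. Moving mass from the `i`-th sample into `S` costs
at least its distance `D i` to `S ∩ Ξ`, so the supremum is a fractional knapsack problem: maximize
`1/N ∑ p i` with `0 ≤ p ≤ 1` and `1/N ∑ p i * D i ≤ ε`. Its linear programming dual
(`knapsack_duality`) minimizes `lam * ε + 1/N ∑ s i` with `s i ≥ 0` and `s i ≥ 1 - lam * D i`. It
remains to dualize `lam * D i`. By Hahn–Banach and Farkas (`scaled_distance_duality`), for a
polyhedron it is bounded by a nonnegative combination of the constraint violations at the sample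
whose normal vector has dual norm at most `lam`; the weights are `γ` and `θ`. In (ii) `S ∩ Ξ` is one
polyhedron. In (i) it is a union of `K` polyhedra, whence one constraint per `k`. The upper bounds
rest on `supProb_le`, the lower bounds on `le_supProb_of_transport`. -/

namespace WassersteinUQ

/-! ### Farkas' lemma and linear programming duality -/

section

/-- **Farkas' lemma** for finitely many linear functionals on a real vector space. -/
theorem farkas_finset {V ι : Type*} [AddCommGroup V] [Module ℝ V]
    (t : Finset ι) : ∀ (a : ι → V →ₗ[ℝ] ℝ) (c : V →ₗ[ℝ] ℝ),
    (∀ x, (∀ i ∈ t, a i x ≤ 0) → c x ≤ 0) →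
    ∃ μ : ι → ℝ, (∀ i, 0 ≤ μ i) ∧ ∑ i ∈ t, μ i • a i = c := by
  classical
  induction t using Finset.induction_on with
  | empty =>
    intro a c h
    refine ⟨0, fun _ => le_rfl, ?_⟩
    ext x
    have h1 := h x (by simp)
    have h2 := h (-x) (by simp)
    rw [map_neg] at h2
    simp only [Finset.sum_empty, LinearMap.zero_apply]
    linarith
  | insert j t hj ih =>
    intro a c h
    by_cases hc : ∀ x, (∀ i ∈ t, a i x ≤ 0) → c x ≤ 0
    · obtain ⟨μ, hμ, hsum⟩ := ih a c hc
      refine ⟨Function.update μ j 0, fun i => ?_, ?_⟩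
      · by_cases hi : i = j
        · simp [hi]
        · simpa [hi] using hμ i
      · rw [Finset.sum_insert hj, Function.update_self, zero_smul, zero_add, ← hsum]
        refine Finset.sum_congr rfl fun i hi => ?_
        rw [Function.update_of_ne (ne_of_mem_of_not_mem hi hj)]
    · push Not at hc
      obtain ⟨y₀, hy₀, hcy₀⟩ := hc
      have hjy₀ : 0 < a j y₀ := by
        by_contra hle
        push Not at hle
        have := h y₀ (by
          intro i hi
          rcases Finset.mem_insert.mp hi with rfl | hi
          · exact hle
          · exact hy₀ i hi)
        linarith
      obtain ⟨y, hy, hcy, hjy⟩ : ∃ y, (∀ i ∈ t, a i y ≤ 0) ∧ 0 < c y ∧ a j y = 1 := by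
        refine ⟨(a j y₀)⁻¹ • y₀, fun i hi => ?_, ?_, ?_⟩
        · rw [map_smul, smul_eq_mul]
          exact mul_nonpos_of_nonneg_of_nonpos (inv_nonneg.mpr hjy₀.le) (hy₀ i hi)
        · rw [map_smul, smul_eq_mul]
          positivity
        · rw [map_smul, smul_eq_mul, inv_mul_cancel₀ hjy₀.ne']
      -- Since `a j y = 1`, `x - a j x • y` projects `x` onto the kernel of `a j`; the induction
      -- hypothesis is applied to the functionals precomposed with this projection.
      obtain ⟨μ, hμ, hsum⟩ := ih (fun i => a i - a i y • a j) (c - c y • a j) (by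
        intro x hx
        have := h (x - a j x • y) (by
          intro i hi
          rcases Finset.mem_insert.mp hi with rfl | hi
          · simp [hjy]
          · have := hx i hi
            simp only [LinearMap.sub_apply, LinearMap.smul_apply, smul_eq_mul] at this
            simp only [map_sub, map_smul, smul_eq_mul]
            linarith)
        simp only [map_sub, map_smul, smul_eq_mul] at this
        simp only [LinearMap.sub_apply, LinearMap.smul_apply, smul_eq_mul]
        linarith)
      refine ⟨Function.update μ j (c y - ∑ i ∈ t, μ i * a i y), fun i => ?_, ?_⟩
      · by_cases hi : i = j
        · subst hi
          have : ∑ k ∈ t, μ k * a k y ≤ 0 :=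
            Finset.sum_nonpos fun k hk => mul_nonpos_of_nonneg_of_nonpos (hμ k) (hy k hk)
          rw [Function.update_self]
          linarith
        · simpa [hi] using hμ i
      · have hupd : ∑ i ∈ t, Function.update μ j (c y - ∑ i ∈ t, μ i * a i y) i • a i
            = ∑ i ∈ t, μ i • a i := by
          refine Finset.sum_congr rfl fun i hi => ?_
          rw [Function.update_of_ne (ne_of_mem_of_not_mem hi hj)]
        rw [Finset.sum_insert hj, Function.update_self, hupd]
        ext x
        have hx := LinearMap.congr_fun hsum x
        simp only [LinearMap.sum_apply, LinearMap.sub_apply, LinearMap.smul_apply, smul_eq_mul,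
          LinearMap.add_apply, mul_sub, Finset.sum_sub_distrib] at hx ⊢
        have h3 : ∑ i ∈ t, μ i * (a i y * a j x) = (∑ i ∈ t, μ i * a i y) * a j x := by
          rw [Finset.sum_mul]
          exact Finset.sum_congr rfl fun i _ => by ring
        rw [h3] at hx
        linarith

/-- The affine form of Farkas' lemma: a linear inequality valid on a nonempty polyhedron is a
nonnegative combination of the inequalities that define it. -/
theorem farkas_affine {V ι : Type*} [AddCommGroup V] [Module ℝ V] [Fintype ι]
    (a : ι → V →ₗ[ℝ] ℝ) (h : ι → ℝ) (z : V →ₗ[ℝ] ℝ) (c : ℝ)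
    (x₀ : V) (hx₀ : ∀ i, a i x₀ ≤ h i)
    (hz : ∀ x, (∀ i, a i x ≤ h i) → z x ≤ c) :
    ∃ μ : ι → ℝ, (∀ i, 0 ≤ μ i) ∧ (∀ x, ∑ i, μ i * a i x = z x) ∧ ∑ i, μ i * h i ≤ c := by
  -- Homogenization: the polyhedron becomes the cone `a i x ≤ h i * t`, `0 ≤ t`, the index `none`
  -- carrying `0 ≤ t`.
  obtain ⟨μ, hμ, hsum⟩ := farkas_finset (V := V × ℝ) (Finset.univ : Finset (Option ι))
    (fun o => o.elim (-LinearMap.snd ℝ V ℝ)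
      fun i => a i ∘ₗ LinearMap.fst ℝ V ℝ - h i • LinearMap.snd ℝ V ℝ)
    (z ∘ₗ LinearMap.fst ℝ V ℝ - c • LinearMap.snd ℝ V ℝ) (by
      rintro ⟨x, t⟩ hx
      have ht : 0 ≤ t := by simpa using hx none (Finset.mem_univ _)
      have hxi : ∀ i, a i x ≤ h i * t := fun i => by
        simpa using hx (some i) (Finset.mem_univ _)
      simp only [LinearMap.sub_apply, LinearMap.comp_apply, LinearMap.fst_apply,
        LinearMap.smul_apply, LinearMap.snd_apply, smul_eq_mul, sub_nonpos]
      -- At `t = 0`, `x` is a recession direction; if `z x > 0`, a long enough move from `x₀` along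
      -- it would violate the bound `c`.
      rcases ht.eq_or_lt with rfl | ht
      · simp only [mul_zero] at hxi ⊢
        by_contra hpos
        push Not at hpos
        have hr := hz (x₀ + ((|c - z x₀| + 1) / z x) • x) (fun i => by
          rw [map_add, map_smul, smul_eq_mul]
          have := mul_nonpos_of_nonneg_of_nonpos
            (show 0 ≤ (|c - z x₀| + 1) / z x by positivity) (hxi i)
          linarith [hx₀ i])
        rw [map_add, map_smul, smul_eq_mul, div_mul_cancel₀ _ hpos.ne'] at hr
        linarith [le_abs_self (c - z x₀)]
      · have := hz (t⁻¹ • x) (fun i => by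
          rw [map_smul, smul_eq_mul, inv_mul_le_iff₀ ht]
          linarith [hxi i])
        rw [map_smul, smul_eq_mul, inv_mul_le_iff₀ ht] at this
        linarith)
  have key : ∀ x t, -(μ none * t) + ∑ i, μ (some i) * (a i x - h i * t) = z x - c * t := by
    intro x t
    have := LinearMap.congr_fun hsum (x, t)
    simpa [LinearMap.sum_apply, Fintype.sum_option] using this
  refine ⟨fun i => μ (some i), fun i => hμ _, fun x => ?_, ?_⟩
  · simpa using key x 0
  · have := key 0 1
    simp only [map_zero, mul_one, zero_sub, mul_neg, Finset.sum_neg_distrib] at this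
    linarith [hμ none]

/-- Strong duality for the fractional knapsack problem
`max {∑ p_i : 0 ≤ p ≤ 1, ∑ p_i D_i ≤ R}`. -/
theorem knapsack_duality {ι : Type*} [Fintype ι] (D : ι → ℝ) (R v : ℝ) (hR : 0 ≤ R)
    (hv : ∀ p : ι → ℝ, (∀ i, 0 ≤ p i) → (∀ i, p i ≤ 1) → ∑ i, p i * D i ≤ R → ∑ i, p i ≤ v) :
    ∃ (lam : ℝ) (s : ι → ℝ), 0 ≤ lam ∧ (∀ i, 0 ≤ s i) ∧ (∀ i, 1 - lam * D i ≤ s i) ∧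
      lam * R + ∑ i, s i ≤ v := by
  classical
  obtain ⟨μ, hμ, hsum, hle⟩ := farkas_affine (V := ι → ℝ) (ι := Option (ι ⊕ ι))
    (fun o => o.elim (∑ i, D i • LinearMap.proj i)
      (Sum.elim (fun i => LinearMap.proj i) (fun i => -LinearMap.proj i)))
    (fun o => o.elim R (Sum.elim (fun _ => 1) (fun _ => 0)))
    (∑ i, LinearMap.proj i) v 0
    (by rintro (_ | _ | _) <;> simp [hR])
    (by
      intro p hp
      simp only [LinearMap.sum_apply, LinearMap.proj_apply]
      refine hv p (fun i => by simpa using hp (some (.inr i)))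
        (fun i => by simpa using hp (some (.inl i))) ?_
      simpa [LinearMap.sum_apply, mul_comm] using hp none)
  -- `lam` prices the budget and `s i` the bound `p i ≤ 1`; the multiplier of `0 ≤ p i` is the slack
  -- in `1 - lam * D i ≤ s i`.
  refine ⟨μ none, fun i => μ (some (.inl i)), hμ _, fun i => hμ _, fun i => ?_, ?_⟩
  · have h1 := hsum (Pi.single i 1)
    simp only [Fintype.sum_option, Fintype.sum_sum_type, Option.elim, Sum.elim_inl, Sum.elim_inr,
      LinearMap.sum_apply, LinearMap.smul_apply, LinearMap.neg_apply, LinearMap.proj_apply,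
      Pi.single_apply, smul_eq_mul, mul_ite, mul_one, mul_zero, mul_neg, Finset.sum_ite_eq',
      Finset.mem_univ, if_true, Finset.sum_neg_distrib] at h1
    linarith [hμ (some (.inr i))]
  · simpa [Fintype.sum_option, Fintype.sum_sum_type] using hle

end

/-! ### Norms on `ℝ^m`, nearest points and the dual norm -/

section

variable {m : ℕ} {nrm : Seminorm ℝ (Fin m → ℝ)}

theorem continuous_seminorm (nrm : Seminorm ℝ (Fin m → ℝ)) : Continuous nrm := by
  rw [← continuousOn_univ]
  exact nrm.convexOn.continuousOn isOpen_univ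

/-- A norm on `ℝ^m` dominates a positive multiple of the supremum norm. -/
theorem exists_pos_mul_norm_le (hnrm : ∀ ξ, nrm ξ = 0 → ξ = 0) :
    ∃ c : ℝ, 0 < c ∧ ∀ ξ, c * ‖ξ‖ ≤ nrm ξ := by
  -- The unit sphere is empty exactly when `m = 0`.
  by_cases hne : (Metric.sphere (0 : Fin m → ℝ) 1).Nonempty
  · obtain ⟨u, hu, hmin⟩ := (isCompact_sphere (0 : Fin m → ℝ) 1).exists_isMinOn hne
      (continuous_seminorm nrm).continuousOn
    have hu0 : u ≠ 0 := by
      rintro rfl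
      simp at hu
    refine ⟨nrm u, (apply_nonneg nrm u).lt_of_ne fun h => hu0 (hnrm u h.symm), fun ξ => ?_⟩
    by_cases hξ : ξ = 0
    · simp [hξ]
    have hpos : 0 < ‖ξ‖ := norm_pos_iff.mpr hξ
    have h1 : nrm u ≤ nrm (‖ξ‖⁻¹ • ξ) := hmin (by
      simp [norm_smul, hpos.ne'])
    rw [map_smul_eq_mul, Real.norm_of_nonneg (by positivity), inv_mul_eq_div,
      le_div_iff₀ hpos] at h1
    exact h1
  · refine ⟨1, one_pos, fun ξ => ?_⟩
    by_cases hξ : ξ = 0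
    · simp [hξ]
    · exact absurd ⟨‖ξ‖⁻¹ • ξ, by simp [norm_smul, hξ]⟩ hne

/-- A nonempty closed set contains a point nearest to a given point. -/
theorem exists_nearest (hnrm : ∀ ξ, nrm ξ = 0 → ξ = 0) {T : Set (Fin m → ℝ)}
    (hT : IsClosed T) (hne : T.Nonempty) (x : Fin m → ℝ) :
    ∃ η ∈ T, ∀ ξ ∈ T, nrm (x - η) ≤ nrm (x - ξ) := by
  obtain ⟨c, hc, hle⟩ := exists_pos_mul_norm_le hnrm
  obtain ⟨ξ₀, hξ₀⟩ := hne
  have hcont : Continuous fun ξ => nrm (x - ξ) :=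
    (continuous_seminorm nrm).comp (continuous_const.sub continuous_id)
  obtain ⟨η, ⟨hη, hηb⟩, hmin⟩ :=
    ((isCompact_closedBall x (nrm (x - ξ₀) / c)).inter_left hT).exists_isMinOn
      ⟨ξ₀, hξ₀, by
        rw [Metric.mem_closedBall, dist_comm, dist_eq_norm, le_div_iff₀ hc, mul_comm]
        exact hle _⟩ hcont.continuousOn
  have hξ₀mem : ξ₀ ∈ T ∩ Metric.closedBall x (nrm (x - ξ₀) / c) := ⟨hξ₀, by
    rw [Metric.mem_closedBall, dist_comm, dist_eq_norm, le_div_iff₀ hc, mul_comm]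
    exact hle _⟩
  refine ⟨η, hη, fun ξ hξ => ?_⟩
  by_cases hb : ξ ∈ Metric.closedBall x (nrm (x - ξ₀) / c)
  · exact hmin ⟨hξ, hb⟩
  · rw [Metric.mem_closedBall, dist_comm, dist_eq_norm, le_div_iff₀ hc, mul_comm, not_le] at hb
    exact (hmin hξ₀mem).trans (hb.le.trans (hle _))

/-- Boundedness is needed because `sSup` of an unbounded set of reals is `0` by convention. -/
theorem bddAbove_dualNorm (hnrm : ∀ ξ, nrm ξ = 0 → ξ = 0) (z : Fin m → ℝ) :
    BddAbove ((fun ξ : Fin m → ℝ => z ⬝ᵥ ξ) '' {ξ | nrm ξ ≤ 1}) := by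
  obtain ⟨c, hc, hle⟩ := exists_pos_mul_norm_le hnrm
  refine ⟨∑ i, |z i| * (1 / c), ?_⟩
  rintro _ ⟨ξ, hξ, rfl⟩
  refine Finset.sum_le_sum fun i _ => ?_
  have h1 : ‖ξ‖ ≤ 1 / c := by
    rw [le_div_iff₀ hc, mul_comm]
    exact (hle ξ).trans hξ
  calc z i * ξ i ≤ |z i * ξ i| := le_abs_self _
    _ = |z i| * |ξ i| := abs_mul _ _
    _ ≤ |z i| * (1 / c) :=
      mul_le_mul_of_nonneg_left ((norm_le_pi_norm ξ i).trans h1) (abs_nonneg _)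

theorem dualNorm_nonneg (hnrm : ∀ ξ, nrm ξ = 0 → ξ = 0) (z : Fin m → ℝ) :
    0 ≤ dualNorm nrm z :=
  le_csSup (bddAbove_dualNorm hnrm z) ⟨0, by simp, by simp⟩

/-- The generalized Cauchy–Schwarz inequality for a norm and its dual norm. -/
theorem dotProduct_le_dualNorm_mul (hnrm : ∀ ξ, nrm ξ = 0 → ξ = 0) (z ξ : Fin m → ℝ) :
    z ⬝ᵥ ξ ≤ dualNorm nrm z * nrm ξ := by
  by_cases h0 : nrm ξ = 0
  · simp [hnrm ξ h0]
  have hpos : 0 < nrm ξ := (apply_nonneg nrm ξ).lt_of_ne' h0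
  have : z ⬝ᵥ ((nrm ξ)⁻¹ • ξ) ≤ dualNorm nrm z :=
    le_csSup (bddAbove_dualNorm hnrm z) ⟨(nrm ξ)⁻¹ • ξ, by
      simp only [Set.mem_ofPred_eq]
      rw [map_smul_eq_mul, Real.norm_of_nonneg (by positivity), inv_mul_cancel₀ h0], rfl⟩
  rwa [dotProduct_smul, smul_eq_mul, inv_mul_eq_div, div_le_iff₀ hpos] at this

theorem dualNorm_le {z : Fin m → ℝ} {lam : ℝ} (hlam : 0 ≤ lam)
    (h : ∀ ξ, z ⬝ᵥ ξ ≤ lam * nrm ξ) : dualNorm nrm z ≤ lam := by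
  refine csSup_le ⟨_, 0, by simp, rfl⟩ ?_
  rintro _ ⟨ξ, hξ, rfl⟩
  exact (h ξ).trans (mul_le_of_le_one_right hlam hξ)

end

/-! ### Distance to a polyhedron -/

section

variable {m : ℕ} {nrm : Seminorm ℝ (Fin m → ℝ)}

/-- Strong duality for the distance from `x` to a polyhedron, where `η` is a nearest point. -/
theorem distance_duality {ι : Type*} [Fintype ι] (a : ι → Fin m → ℝ) (h : ι → ℝ)
    (x η : Fin m → ℝ) (hη : ∀ i, a i ⬝ᵥ η ≤ h i)
    (hmin : ∀ ξ, (∀ i, a i ⬝ᵥ ξ ≤ h i) → nrm (x - η) ≤ nrm (x - ξ)) :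
    ∃ μ : ι → ℝ, (∀ i, 0 ≤ μ i) ∧ (∀ ξ, ∑ i, μ i * (a i ⬝ᵥ ξ) ≤ nrm ξ) ∧
      nrm (x - η) ≤ ∑ i, μ i * (a i ⬝ᵥ x - h i) := by
  rcases (apply_nonneg nrm (x - η)).eq_or_lt with h0 | hD
  · exact ⟨0, fun _ => le_rfl, fun ξ => by simp, by simp [← h0]⟩
  set D := nrm (x - η) with hDdef
  have hcont : Continuous fun ξ => nrm (x - ξ) :=
    (continuous_seminorm nrm).comp (continuous_const.sub continuous_id)
  have hball : Convex ℝ {ξ | nrm (x - ξ) < D} := by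
    have : {ξ | nrm (x - ξ) < D} = nrm.ball x D := by
      ext ξ
      rw [Seminorm.mem_ball, ← map_neg_eq_map nrm, neg_sub]
      rfl
    rw [this]
    exact nrm.convex_ball x D
  have hpoly : Convex ℝ {ξ | ∀ i, a i ⬝ᵥ ξ ≤ h i} := by
    intro ξ hξ ζ hζ r t hr ht hrt i
    rw [dotProduct_add, dotProduct_smul, dotProduct_smul, smul_eq_mul, smul_eq_mul]
    calc _ ≤ r * h i + t * h i := add_le_add (mul_le_mul_of_nonneg_left (hξ i) hr)
          (mul_le_mul_of_nonneg_left (hζ i) ht)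
      _ = h i := by rw [← add_mul, hrt, one_mul]
  -- Separates the open ball of radius `D` about `x` from the polyhedron; the ball is nonempty
  -- because the case `D = 0` has been removed.
  obtain ⟨f, u, hfu, huf⟩ := geometric_hahn_banach_open hball
    (isOpen_lt hcont continuous_const) hpoly
    (Set.disjoint_left.mpr fun ξ hξ hξ' => (hmin ξ hξ').not_gt hξ)
  have ht : 0 < u - f x := sub_pos.mpr (hfu x (by simpa using hD))
  obtain ⟨μ, hμ, hsum, hle⟩ := farkas_affine (fun i => dotProductBilin ℝ ℝ (a i)) h
    (-(f : (Fin m → ℝ) →ₗ[ℝ] ℝ)) (-u) η hη (fun ξ hξ => neg_le_neg (huf ξ hξ))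
  replace hsum : ∀ ξ, ∑ i, μ i * (a i ⬝ᵥ ξ) = -f ξ := hsum
  -- The dual norm of `-f` is at most `(u - f x) / D`: test `f < u` at points of the open ball, then
  -- let `r` decrease to `nrm w`.
  have hf : ∀ w, -f w * D ≤ (u - f x) * nrm w := by
    intro w
    have hlt : ∀ r, 0 < r → nrm w < r → -f w * D ≤ (u - f x) * r := by
      intro r hr hwr
      have := hfu (x - (D / r) • w) (by
        simp only [Set.mem_ofPred_eq, sub_sub_cancel]
        rw [map_smul_eq_mul, Real.norm_of_nonneg (by positivity), div_mul_eq_mul_div,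
          div_lt_iff₀ hr]
        exact mul_lt_mul_of_pos_left hwr hD)
      rw [map_sub, map_smul, smul_eq_mul] at this
      have h2 : -f w * D / r ≤ u - f x := by
        have : -f w * D / r = -(D / r * f w) := by ring
        linarith
      rwa [div_le_iff₀ hr] at h2
    refine le_of_forall_pos_le_add fun δ hδ => ?_
    have hδ' : 0 < δ / (u - f x) := by positivity
    have := hlt (nrm w + δ / (u - f x)) (add_pos_of_nonneg_of_pos (apply_nonneg _ _) hδ')
      (lt_add_of_pos_right _ hδ')
    rwa [mul_add, mul_div_cancel₀ _ ht.ne'] at this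
  -- This scaling brings the dual norm down to at most `1` and turns the gap `u - f x` into `D`.
  refine ⟨fun i => D / (u - f x) * μ i, fun i => mul_nonneg (by positivity) (hμ i),
    fun ξ => ?_, ?_⟩
  · simp only [mul_assoc]
    rw [← Finset.mul_sum, hsum, div_mul_eq_mul_div, div_le_iff₀ ht]
    linarith [hf ξ]
  · simp only [mul_assoc]
    rw [← Finset.mul_sum, div_mul_eq_mul_div, le_div_iff₀ ht]
    refine mul_le_mul_of_nonneg_left ?_ hD.le
    simp only [mul_sub, Finset.sum_sub_distrib]
    rw [hsum]
    linarith

/-- Duality for the distance to a polyhedron, scaled by a nonnegative factor. -/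
theorem scaled_distance_duality {ι : Type*} [Fintype ι] (a : ι → Fin m → ℝ) (h : ι → ℝ)
    (x η : Fin m → ℝ) (hη : ∀ i, a i ⬝ᵥ η ≤ h i)
    (hmin : ∀ ξ, (∀ i, a i ⬝ᵥ ξ ≤ h i) → nrm (x - η) ≤ nrm (x - ξ)) {lam : ℝ} (hlam : 0 ≤ lam) :
    ∃ μ : ι → ℝ, (∀ i, 0 ≤ μ i) ∧ (∀ ξ, ∑ i, μ i * (a i ⬝ᵥ ξ) ≤ lam * nrm ξ) ∧
      lam * nrm (x - η) ≤ ∑ i, μ i * (a i ⬝ᵥ x - h i) := by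
  obtain ⟨μ, hμ, h1, h2⟩ := distance_duality a h x η hη hmin
  refine ⟨fun i => lam * μ i, fun i => mul_nonneg hlam (hμ i), fun ξ => ?_, ?_⟩
  · simp only [mul_assoc, ← Finset.mul_sum]
    exact mul_le_mul_of_nonneg_left (h1 ξ) hlam
  · simp only [mul_assoc, ← Finset.mul_sum]
    exact mul_le_mul_of_nonneg_left h2 hlam

theorem isClosed_closedPolytope {J : ℕ} (C : Matrix (Fin J) (Fin m) ℝ) (d : Fin J → ℝ) :
    IsClosed (closedPolytope C d) := by
  have : closedPolytope C d = ⋂ j, {ξ | (C *ᵥ ξ) j ≤ d j} := by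
    ext ξ
    simp [closedPolytope]
  rw [this]
  refine isClosed_iInter fun j => isClosed_le ?_ continuous_const
  simp only [mulVec, dotProduct]
  fun_prop

theorem isOpen_openPolytope {K : ℕ} (A : Matrix (Fin K) (Fin m) ℝ) (b : Fin K → ℝ) :
    IsOpen (openPolytope A b) := by
  have : openPolytope A b = ⋂ k, {ξ | (A *ᵥ ξ) k < b k} := by
    ext ξ
    simp [openPolytope]
  rw [this]
  refine isOpen_iInter_of_finite fun k => isOpen_lt ?_ continuous_const
  simp only [mulVec, dotProduct]
  fun_prop

end

/-! ### The probability over the Wasserstein ball as a knapsack problem -/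

section

variable {m N : ℕ} {nrm : Seminorm ℝ (Fin m → ℝ)}

theorem lintegral_empirical (ξhat : Fin N → Fin m → ℝ) (f : (Fin m → ℝ) → ℝ≥0∞) :
    ∫⁻ x, f x ∂(empirical ξhat) = (N : ℝ≥0∞)⁻¹ * ∑ i, f (ξhat i) := by
  rw [empirical, lintegral_smul_measure, lintegral_finsetSum_measure]
  simp [lintegral_dirac]

theorem inv_natCast_mul_sum_ofReal (hN : 0 < N) {s : Fin N → ℝ} (hs : ∀ i, 0 ≤ s i) :
    (N : ℝ≥0∞)⁻¹ * ∑ i, ENNReal.ofReal (s i) = ENNReal.ofReal (1 / (N : ℝ) * ∑ i, s i) := by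
  have hN' : (0 : ℝ) < N := by exact_mod_cast hN
  rw [ENNReal.ofReal_mul (by positivity), one_div, ENNReal.ofReal_inv_of_pos hN',
    ENNReal.ofReal_natCast, ENNReal.ofReal_sum_of_nonneg fun i _ => hs i]

/-- Weak duality: the cost `λ‖x - ξ‖ + s_i` dominates the indicator of `S` on `Ξ`. -/
theorem supProb_le (hN : 0 < N) {Ξ S : Set (Fin m → ℝ)} (hS : MeasurableSet S)
    (ξhat : Fin N → Fin m → ℝ) {ε lam : ℝ} (hε : 0 ≤ ε) (hlam : 0 ≤ lam) {s : Fin N → ℝ}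
    (hs : ∀ i, 0 ≤ s i)
    (h : ∀ i, ∀ ξ ∈ S ∩ Ξ, 1 - lam * nrm (ξhat i - ξ) ≤ s i) :
    supProb nrm Ξ ξhat ε S ≤ ((lam * ε + 1 / (N : ℝ) * ∑ i, s i : ℝ) : EReal) := by
  refine iSup₂_le fun Q hQ => ?_
  obtain ⟨⟨hprob, hsupp, -⟩, hW⟩ := hQ
  have hcost : Measurable fun p : (Fin m → ℝ) × (Fin m → ℝ) =>
      ENNReal.ofReal (nrm (p.1 - p.2)) :=
    ENNReal.measurable_ofReal.comp
      ((continuous_seminorm nrm).comp (continuous_fst.sub continuous_snd)).measurable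
  have hsum : 0 ≤ 1 / (N : ℝ) * ∑ i, s i :=
    mul_nonneg (by positivity) (Finset.sum_nonneg fun i _ => hs i)
  have hcoupling : ∀ P ∈ couplings (empirical ξhat) Q,
      Q S ≤ ENNReal.ofReal lam * ∫⁻ p, ENNReal.ofReal (nrm (p.1 - p.2)) ∂P +
        ENNReal.ofReal (1 / (N : ℝ) * ∑ i, s i) := by
    rintro P ⟨hP1, hP2⟩
    -- Samples may coincide, so the least `s i` at each point is used. Off the samples `f` is `⊤`,
    -- harmlessly, as the first marginal does not charge such points.
    set f : (Fin m → ℝ) → ℝ≥0∞ := fun x => ⨅ (i) (_ : ξhat i = x), ENNReal.ofReal (s i) with hf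
    have hmem : ∀ᵐ p ∂P, p.2 ∈ Ξ := by
      refine ae_of_ae_map (p := fun x => x ∈ Ξ) measurable_snd.aemeasurable ?_
      rw [hP2]
      exact hsupp
    have hle : ∀ᵐ p ∂P, S.indicator (fun _ => (1 : ℝ≥0∞)) p.2 ≤
        ENNReal.ofReal lam * ENNReal.ofReal (nrm (p.1 - p.2)) + f p.1 := by
      filter_upwards [hmem] with p hp
      by_cases hpS : p.2 ∈ S
      · rw [Set.indicator_of_mem hpS, ← tsub_le_iff_left]
        refine le_iInf₂ fun i hi => ?_
        rw [tsub_le_iff_left, ← ENNReal.ofReal_mul hlam,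
          ← ENNReal.ofReal_add (mul_nonneg hlam (apply_nonneg _ _)) (hs i), ENNReal.one_le_ofReal]
        have := h i p.2 ⟨hpS, hp⟩
        rw [hi] at this
        linarith
      · rw [Set.indicator_of_notMem hpS]
        exact zero_le
    calc Q S = ∫⁻ p, S.indicator (fun _ => (1 : ℝ≥0∞)) p.2 ∂P := by
          rw [← lintegral_map (measurable_const.indicator hS) measurable_snd, hP2,
            lintegral_indicator_const hS, one_mul]
      _ ≤ ∫⁻ p, (ENNReal.ofReal lam * ENNReal.ofReal (nrm (p.1 - p.2)) + f p.1) ∂P :=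
          lintegral_mono_ae hle
      _ = ENNReal.ofReal lam * ∫⁻ p, ENNReal.ofReal (nrm (p.1 - p.2)) ∂P + ∫⁻ p, f p.1 ∂P := by
          rw [lintegral_add_left (hcost.const_mul _), lintegral_const_mul _ hcost]
      _ ≤ _ := by
          gcongr
          calc ∫⁻ p, f p.1 ∂P = ∫⁻ p, f p ∂(P.map Prod.fst) := by
                have : Measurable f := by
                  refine Measurable.iInf fun i => ?_
                  have heq : (fun x => ⨅ (_ : ξhat i = x), ENNReal.ofReal (s i)) =
                      fun x => ({ξhat i} : Set (Fin m → ℝ)).piecewise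
                        (fun _ => ENNReal.ofReal (s i)) (fun _ => ⊤) x := by
                    classical
                    funext x
                    by_cases hx : x = ξhat i
                    · subst hx; simp
                    · simp [hx, Ne.symm hx]
                  rw [heq]
                  exact Measurable.piecewise (measurableSet_singleton _) measurable_const
                    measurable_const
                rw [lintegral_map this measurable_fst]
            _ ≤ (N : ℝ≥0∞)⁻¹ * ∑ i, ENNReal.ofReal (s i) := by
                rw [hP1, lintegral_empirical]
                gcongr with i
                exact iInf₂_le (f := fun j (_ : ξhat j = ξhat i) => ENNReal.ofReal (s j)) i rfl
            _ = _ := inv_natCast_mul_sum_ofReal hN hs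
  have hfin : Q S ≤ ENNReal.ofReal (lam * ε + 1 / (N : ℝ) * ∑ i, s i) := by
    rw [ENNReal.ofReal_add (mul_nonneg hlam hε) hsum, ENNReal.ofReal_mul hlam]
    refine ENNReal.le_of_forall_pos_le_add fun δ hδ _ => ?_
    -- A nearly optimal coupling suffices, so attainment is not needed; `lam + 1` keeps the divisor
    -- positive when `lam = 0`.
    have hlt : wasserstein nrm (empirical ξhat) Q <
        ENNReal.ofReal ε + δ / ENNReal.ofReal (lam + 1) :=
      hW.trans_lt (ENNReal.lt_add_right ENNReal.ofReal_ne_top (by simp [hδ.ne']))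
    simp only [wasserstein, iInf_lt_iff] at hlt
    obtain ⟨P, hP, hPlt⟩ := hlt
    have hdiv : ENNReal.ofReal lam * (δ / ENNReal.ofReal (lam + 1)) ≤ δ := by
      calc _ ≤ ENNReal.ofReal (lam + 1) * (δ / ENNReal.ofReal (lam + 1)) := by
            gcongr
            linarith
        _ ≤ δ := ENNReal.mul_div_le
    calc Q S ≤ _ := hcoupling P hP
      _ ≤ ENNReal.ofReal lam * (ENNReal.ofReal ε + δ / ENNReal.ofReal (lam + 1)) +
          ENNReal.ofReal (1 / (N : ℝ) * ∑ i, s i) := by gcongr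
      _ ≤ _ := by
        rw [mul_add, add_right_comm]
        gcongr
  calc ((Q S : ℝ≥0∞) : EReal) ≤ (ENNReal.ofReal (lam * ε + 1 / (N : ℝ) * ∑ i, s i) : ℝ≥0∞) :=
        EReal.coe_ennreal_le_coe_ennreal_iff.mpr hfin
    _ = _ := by
        rw [EReal.coe_ennreal_ofReal, max_eq_left (add_nonneg (mul_nonneg hlam hε) hsum)]

/-- Moving the fraction `p i` of the `i`-th sample to the point `η i` of `S` gives a distribution
in the Wasserstein ball. -/
theorem le_supProb_of_transport (hN : 0 < N) {Ξ S : Set (Fin m → ℝ)} (hS : MeasurableSet S)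
    (hΞ : MeasurableSet Ξ) {ξhat η : Fin N → Fin m → ℝ} (hξhat : ∀ i, ξhat i ∈ Ξ)
    (hη : ∀ i, η i ∈ S ∩ Ξ) {ε : ℝ} {p : Fin N → ℝ} (hp0 : ∀ i, 0 ≤ p i) (hp1 : ∀ i, p i ≤ 1)
    (hp : ∑ i, p i * nrm (ξhat i - η i) ≤ N * ε) :
    ((1 / (N : ℝ) * ∑ i, p i : ℝ) : EReal) ≤ supProb nrm Ξ ξhat ε S := by
  have hN' : (0 : ℝ) < N := by exact_mod_cast hN
  set P : Measure ((Fin m → ℝ) × (Fin m → ℝ)) := (N : ℝ≥0∞)⁻¹ • ∑ i,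
    (ENNReal.ofReal (1 - p i) • Measure.dirac (ξhat i, ξhat i) +
      ENNReal.ofReal (p i) • Measure.dirac (ξhat i, η i)) with hP
  have hmass : ∀ i, ENNReal.ofReal (1 - p i) + ENNReal.ofReal (p i) = 1 := fun i => by
    rw [← ENNReal.ofReal_add (by linarith [hp1 i]) (hp0 i)]
    simp
  have hint : ∀ f : (Fin m → ℝ) × (Fin m → ℝ) → ℝ≥0∞, ∫⁻ x, f x ∂P = (N : ℝ≥0∞)⁻¹ *
      ∑ i, (ENNReal.ofReal (1 - p i) * f (ξhat i, ξhat i) +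
        ENNReal.ofReal (p i) * f (ξhat i, η i)) := by
    intro f
    rw [hP, lintegral_smul_measure, lintegral_finsetSum_measure]
    simp [lintegral_add_measure, lintegral_smul_measure, lintegral_dirac]
  have hintQ : ∀ f : (Fin m → ℝ) → ℝ≥0∞, Measurable f → ∫⁻ x, f x ∂(P.map Prod.snd) =
      (N : ℝ≥0∞)⁻¹ * ∑ i, (ENNReal.ofReal (1 - p i) * f (ξhat i) +
        ENNReal.ofReal (p i) * f (η i)) := by
    intro f hf
    rw [lintegral_map hf measurable_snd, hint]
  have hQ : ∀ T : Set (Fin m → ℝ), MeasurableSet T → (P.map Prod.snd) T =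
      (N : ℝ≥0∞)⁻¹ * ∑ i, (ENNReal.ofReal (1 - p i) * T.indicator 1 (ξhat i) +
        ENNReal.ofReal (p i) * T.indicator 1 (η i)) := by
    intro T hT
    rw [← lintegral_indicator_one hT, hintQ _ (measurable_one.indicator hT)]
  have hfst : P.map Prod.fst = empirical ξhat := by
    refine Measure.ext_of_lintegral _ fun f hf => ?_
    rw [lintegral_map hf measurable_fst, hint, lintegral_empirical]
    simp only [← add_mul, hmass, one_mul]
  have hball : P.map Prod.snd ∈ wassersteinBall nrm Ξ (empirical ξhat) ε := by
    refine ⟨⟨⟨?_⟩, ?_, ?_⟩, ?_⟩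
    · rw [hQ _ MeasurableSet.univ]
      simp [hmass, ENNReal.inv_mul_cancel, hN.ne']
    · rw [hQ _ hΞ.compl]
      simp [hξhat, (hη _).2]
    · rw [hintQ (fun ξ => ENNReal.ofReal (nrm ξ))
        (ENNReal.measurable_ofReal.comp (continuous_seminorm nrm).measurable)]
      refine ENNReal.mul_lt_top (by simp [hN]) (ENNReal.sum_lt_top.mpr fun i _ => ?_)
      exact ENNReal.add_lt_top.mpr ⟨ENNReal.mul_lt_top ENNReal.ofReal_lt_top ENNReal.ofReal_lt_top,
        ENNReal.mul_lt_top ENNReal.ofReal_lt_top ENNReal.ofReal_lt_top⟩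
    · refine (iInf₂_le P ⟨hfst, rfl⟩).trans ?_
      rw [hint]
      simp only [sub_self, map_zero, ENNReal.ofReal_zero, mul_zero, zero_add,
        ← ENNReal.ofReal_mul (hp0 _)]
      rw [inv_natCast_mul_sum_ofReal hN fun i => mul_nonneg (hp0 i) (apply_nonneg _ _)]
      refine ENNReal.ofReal_le_ofReal ?_
      rw [one_div, inv_mul_le_iff₀ hN']
      exact hp
  refine le_trans ?_ (le_iSup₂ (f := fun Q (_ : Q ∈ wassersteinBall nrm Ξ (empirical ξhat) ε) =>
    ((Q S : ℝ≥0∞) : EReal)) _ hball)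
  -- Only an inequality: unmoved mass may also lie in `S`.
  have hQS : ENNReal.ofReal (1 / (N : ℝ) * ∑ i, p i) ≤ (P.map Prod.snd) S := by
    rw [hQ S hS, ← inv_natCast_mul_sum_ofReal hN hp0]
    gcongr with i
    rw [Set.indicator_of_mem (hη i).1, Pi.one_apply, mul_one]
    exact le_add_self
  calc ((1 / (N : ℝ) * ∑ i, p i : ℝ) : EReal)
      ≤ (ENNReal.ofReal (1 / (N : ℝ) * ∑ i, p i) : ℝ≥0∞) := by
        rw [EReal.coe_ennreal_ofReal]
        exact EReal.coe_le_coe_iff.mpr (le_max_left _ _)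
    _ ≤ _ := EReal.coe_ennreal_le_coe_ennreal_iff.mpr hQS

theorem supProb_le_one {Ξ S : Set (Fin m → ℝ)} (ξhat : Fin N → Fin m → ℝ) (ε : ℝ) :
    supProb nrm Ξ ξhat ε S ≤ 1 := by
  refine iSup₂_le fun Q hQ => ?_
  have := hQ.1.1
  exact_mod_cast EReal.coe_ennreal_le_coe_ennreal_iff.mpr (prob_le_one (μ := Q) (s := S))

/-- Strong duality in terms of the distances from the samples to the event `S`. -/
theorem exists_dual_le_supProb (hN : 0 < N) {Ξ S : Set (Fin m → ℝ)} (hS : MeasurableSet S)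
    (hΞ : MeasurableSet Ξ) {ξhat η : Fin N → Fin m → ℝ} (hξhat : ∀ i, ξhat i ∈ Ξ)
    (hη : ∀ i, η i ∈ S ∩ Ξ) {ε : ℝ} (hε : 0 ≤ ε) :
    ∃ (lam : ℝ) (s : Fin N → ℝ), 0 ≤ lam ∧ (∀ i, 0 ≤ s i) ∧
      (∀ i, 1 - lam * nrm (ξhat i - η i) ≤ s i) ∧
      ((lam * ε + 1 / (N : ℝ) * ∑ i, s i : ℝ) : EReal) ≤ supProb nrm Ξ ξhat ε S := by
  have hN' : (0 : ℝ) < N := by exact_mod_cast hN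
  have hlow : (0 : EReal) ≤ supProb nrm Ξ ξhat ε S := by
    have := le_supProb_of_transport (nrm := nrm) hN hS hΞ hξhat hη (ε := ε) (p := 0)
      (fun _ => le_rfl) (fun _ => zero_le_one) (by simpa using by positivity)
    simpa using this
  -- Knapsack duality needs a real value; the bounds `0` and `1` exclude the infinite ones.
  obtain ⟨v, hv⟩ : ∃ v : ℝ, (v : EReal) = supProb nrm Ξ ξhat ε S := by
    refine ⟨_, EReal.coe_toReal (fun htop => ?_) (fun hbot => ?_)⟩
    · have := supProb_le_one (nrm := nrm) (Ξ := Ξ) (S := S) ξhat ε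
      rw [htop] at this
      exact absurd this (by decide)
    · rw [hbot] at hlow
      exact absurd hlow (by decide)
  obtain ⟨lam, s, hlam, hs, hle, hval⟩ := knapsack_duality (fun i => nrm (ξhat i - η i))
    (N * ε) (N * v) (by positivity) (fun p hp0 hp1 hp => by
      have := le_supProb_of_transport hN hS hΞ hξhat hη hp0 hp1 hp
      rw [← hv, EReal.coe_le_coe_iff, one_div, inv_mul_le_iff₀ hN'] at this
      exact this)
  refine ⟨lam, s, hlam, hs, hle, ?_⟩
  rw [← hv, EReal.coe_le_coe_iff]
  have : lam * ε + 1 / (N : ℝ) * ∑ i, s i = (lam * (N * ε) + ∑ i, s i) / N := by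
    field_simp
  rw [this, div_le_iff₀ hN']
  linarith

end

/-! ### The two programs -/

section

variable {m N J K : ℕ} {nrm : Seminorm ℝ (Fin m → ℝ)}

theorem transpose_mulVec_dotProduct (C : Matrix (Fin J) (Fin m) ℝ) (γ : Fin J → ℝ)
    (ξ : Fin m → ℝ) : (Cᵀ *ᵥ γ) ⬝ᵥ ξ = γ ⬝ᵥ (C *ᵥ ξ) := by
  rw [mulVec_transpose, dotProduct_mulVec]

/-- The slack of nonnegatively weighted constraints is nonnegative on a polyhedron. -/
theorem dotProduct_mulVec_le {C : Matrix (Fin J) (Fin m) ℝ} {d γ : Fin J → ℝ} {ξ : Fin m → ℝ}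
    (hγ : ∀ j, 0 ≤ γ j) (hξ : ξ ∈ closedPolytope C d) : γ ⬝ᵥ (C *ᵥ ξ) ≤ γ ⬝ᵥ d :=
  Finset.sum_le_sum fun j _ => mul_le_mul_of_nonneg_left (hξ j) (hγ j)

theorem supProb_le_worstValue (hN : 0 < N) (hnrm : ∀ ξ, nrm ξ = 0 → ξ = 0)
    (C : Matrix (Fin J) (Fin m) ℝ) (d : Fin J → ℝ)
    (A : Matrix (Fin K) (Fin m) ℝ) (b : Fin K → ℝ)
    (ξhat : Fin N → Fin m → ℝ) {ε : ℝ} (hε : 0 ≤ ε) (hK : 0 < K) :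
    supProb nrm (closedPolytope C d) ξhat ε (openPolytope A b)ᶜ ≤
      worstValue nrm C d A b ξhat ε := by
  refine le_iInf fun lam => le_iInf fun s => le_iInf fun γ => le_iInf fun θ => le_iInf fun hF => ?_
  -- `0 ≤ lam` is not among the constraints; it follows from any slope constraint, and `hN`, `hK`
  -- supply one.
  refine supProb_le hN (isOpen_openPolytope A b).measurableSet.compl ξhat hε
    ((dualNorm_nonneg hnrm _).trans (hF.slope ⟨0, hN⟩ ⟨0, hK⟩)) hF.s_nonneg ?_
  rintro i ξ ⟨hξA, hξC⟩
  obtain ⟨k, hk⟩ : ∃ k, b k ≤ A k ⬝ᵥ ξ := by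
    by_contra! hcon
    exact hξA hcon
  have h1 : (θ i k • A k - Cᵀ *ᵥ γ i k) ⬝ᵥ (ξ - ξhat i) ≤ lam * nrm (ξhat i - ξ) := by
    rw [← map_neg_eq_map nrm, neg_sub]
    exact (dotProduct_le_dualNorm_mul hnrm _ _).trans
      (mul_le_mul_of_nonneg_right (hF.slope i k) (apply_nonneg _ _))
  have h2 := hF.epigraph i k
  have h3 := dotProduct_mulVec_le (hF.γ_nonneg i k) hξC
  have h4 := mul_le_mul_of_nonneg_left hk (hF.θ_nonneg i k)
  simp only [sub_dotProduct, smul_dotProduct, smul_eq_mul, transpose_mulVec_dotProduct,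
    dotProduct_sub] at h1
  rw [dotProduct_sub] at h2
  linarith

/-- Each of the `K` pieces is at least as far from a sample as their union is, so the knapsack's
`lam` and `s` work for every `k`; only the multipliers depend on `k`. -/
theorem worstValue_le_supProb (hN : 0 < N) (hnrm : ∀ ξ, nrm ξ = 0 → ξ = 0)
    (C : Matrix (Fin J) (Fin m) ℝ) (d : Fin J → ℝ)
    (A : Matrix (Fin K) (Fin m) ℝ) (b : Fin K → ℝ)
    (ξhat : Fin N → Fin m → ℝ) (hξhat : ∀ i, ξhat i ∈ closedPolytope C d)
    {ε : ℝ} (hε : 0 ≤ ε) (hK : 0 < K)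
    (hne : ∀ k, ({ξ | b k ≤ A k ⬝ᵥ ξ} ∩ closedPolytope C d).Nonempty) :
    worstValue nrm C d A b ξhat ε ≤
      supProb nrm (closedPolytope C d) ξhat ε (openPolytope A b)ᶜ := by
  have hclosed : ∀ k, IsClosed ({ξ | b k ≤ A k ⬝ᵥ ξ} ∩ closedPolytope C d) := fun k =>
    (isClosed_le continuous_const (continuous_const.dotProduct continuous_id)).inter
      (isClosed_closedPolytope C d)
  have hsub : ∀ k, {ξ | b k ≤ A k ⬝ᵥ ξ} ∩ closedPolytope C d ⊆
      (openPolytope A b)ᶜ ∩ closedPolytope C d := fun k ξ hξ =>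
    ⟨fun hA => (hA k).not_ge hξ.1, hξ.2⟩
  choose η hη hηmin using fun i => exists_nearest hnrm
    ((isOpen_openPolytope A b).isClosed_compl.inter (isClosed_closedPolytope C d))
    ((hne ⟨0, hK⟩).mono (hsub _)) (ξhat i)
  choose ζ hζ hζmin using fun i k => exists_nearest hnrm (hclosed k) (hne k) (ξhat i)
  obtain ⟨lam, s, hlam, hs, hle, hval⟩ := exists_dual_le_supProb (nrm := nrm) hN
    (isOpen_openPolytope A b).measurableSet.compl (isClosed_closedPolytope C d).measurableSet
    hξhat hη hε
  -- The halfspace is written as `-a_k ξ ≤ -b_k`; its multiplier, at `none`, becomes `θ`, the others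
  -- `γ`.
  choose μ hμ hslope hepi using fun i k => scaled_distance_duality (nrm := nrm)
    (fun o : Option (Fin J) => o.elim (-A k) C) (fun o => o.elim (-b k) d) (ξhat i) (ζ i k)
    (by
      rintro (_ | j)
      · exact (neg_dotProduct _ _).trans_le (neg_le_neg (hζ i k).1)
      · exact (hζ i k).2 j)
    (fun ξ hξ => hζmin i k ξ ⟨neg_le_neg_iff.mp ((neg_dotProduct _ _).symm.trans_le (hξ none)),
      fun j => hξ (some j)⟩) hlam
  refine le_trans (iInf_le_of_le lam <| iInf_le_of_le s <|
    iInf_le_of_le (fun i k j => μ i k (some j)) <| iInf_le_of_le (fun i k => μ i k none) <|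
    iInf_le_of_le ⟨fun i k => ?_, fun i k => ?_, fun i k j => hμ i k _, fun i k => hμ i k _, hs⟩
      le_rfl) hval
  · have h1 : lam * nrm (ξhat i - ζ i k) ≤ μ i k none * (-A k ⬝ᵥ ξhat i - -b k) +
        ∑ j, μ i k (some j) * (C j ⬝ᵥ ξhat i - d j) :=
      (hepi i k).trans_eq (Fintype.sum_option _)
    have h2 : lam * nrm (ξhat i - η i) ≤ lam * nrm (ξhat i - ζ i k) :=
      mul_le_mul_of_nonneg_left (hηmin i _ (hsub k (hζ i k))) hlam
    rw [neg_dotProduct] at h1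
    have h3 : (fun j => μ i k (some j)) ⬝ᵥ (d - C *ᵥ ξhat i) =
        -∑ j, μ i k (some j) * (C j ⬝ᵥ ξhat i - d j) := by
      rw [dotProduct, ← Finset.sum_neg_distrib]
      refine Finset.sum_congr rfl fun j _ => ?_
      simp only [Pi.sub_apply, mulVec]
      ring
    rw [h3]
    linarith [hle i]
  · refine dualNorm_le hlam fun ξ => ?_
    -- Taken at `-ξ`, because the program's slope vector is the negative of the combined normal
    -- vector.
    have h1 : μ i k none * (-A k ⬝ᵥ -ξ) + ∑ j, μ i k (some j) * (C j ⬝ᵥ -ξ) ≤ lam * nrm (-ξ) :=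
      (Fintype.sum_option _).symm.trans_le (hslope i k (-ξ))
    have h2 : (fun j => μ i k (some j)) ⬝ᵥ (C *ᵥ ξ) = ∑ j, μ i k (some j) * (C j ⬝ᵥ ξ) := rfl
    simp only [neg_dotProduct, dotProduct_neg, neg_neg, mul_neg, Finset.sum_neg_distrib,
      map_neg_eq_map] at h1
    rw [sub_dotProduct, smul_dotProduct, smul_eq_mul, transpose_mulVec_dotProduct, h2]
    linarith

theorem supProb_le_bestValue (hN : 0 < N) (hnrm : ∀ ξ, nrm ξ = 0 → ξ = 0)
    (C : Matrix (Fin J) (Fin m) ℝ) (d : Fin J → ℝ)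
    (A : Matrix (Fin K) (Fin m) ℝ) (b : Fin K → ℝ)
    (ξhat : Fin N → Fin m → ℝ) {ε : ℝ} (hε : 0 ≤ ε) :
    supProb nrm (closedPolytope C d) ξhat ε (closedPolytope A b) ≤
      bestValue nrm C d A b ξhat ε := by
  refine le_iInf fun lam => le_iInf fun s => le_iInf fun γ => le_iInf fun θ => le_iInf fun hF => ?_
  refine supProb_le hN (isClosed_closedPolytope A b).measurableSet ξhat hε
    ((dualNorm_nonneg hnrm _).trans (hF.slope ⟨0, hN⟩)) hF.s_nonneg ?_
  rintro i ξ ⟨hξA, hξC⟩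
  have h1 : (Aᵀ *ᵥ θ i + Cᵀ *ᵥ γ i) ⬝ᵥ (ξhat i - ξ) ≤ lam * nrm (ξhat i - ξ) :=
    (dotProduct_le_dualNorm_mul hnrm _ _).trans
      (mul_le_mul_of_nonneg_right (hF.slope i) (apply_nonneg _ _))
  have h2 := hF.epigraph i
  have h3 := dotProduct_mulVec_le (hF.γ_nonneg i) hξC
  have h4 := dotProduct_mulVec_le (hF.θ_nonneg i) hξA
  simp only [add_dotProduct, transpose_mulVec_dotProduct, dotProduct_sub] at h1
  rw [dotProduct_sub, dotProduct_sub] at h2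
  linarith

/-- Stacking the rows of `A` and `C` describes `S ∩ Ξ` as a single polyhedron, so one nearest point
serves both dualities. -/
theorem bestValue_le_supProb (hN : 0 < N) (hnrm : ∀ ξ, nrm ξ = 0 → ξ = 0)
    (C : Matrix (Fin J) (Fin m) ℝ) (d : Fin J → ℝ)
    (A : Matrix (Fin K) (Fin m) ℝ) (b : Fin K → ℝ)
    (ξhat : Fin N → Fin m → ℝ) (hξhat : ∀ i, ξhat i ∈ closedPolytope C d)
    {ε : ℝ} (hε : 0 ≤ ε) (hne : (closedPolytope A b ∩ closedPolytope C d).Nonempty) :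
    bestValue nrm C d A b ξhat ε ≤
      supProb nrm (closedPolytope C d) ξhat ε (closedPolytope A b) := by
  choose η hη hηmin using fun i => exists_nearest hnrm
    ((isClosed_closedPolytope A b).inter (isClosed_closedPolytope C d)) hne (ξhat i)
  obtain ⟨lam, s, hlam, hs, hle, hval⟩ := exists_dual_le_supProb (nrm := nrm) hN
    (isClosed_closedPolytope A b).measurableSet (isClosed_closedPolytope C d).measurableSet
    hξhat hη hε
  choose μ hμ hslope hepi using fun i => scaled_distance_duality (nrm := nrm)
    (Sum.elim A C : Fin K ⊕ Fin J → Fin m → ℝ) (Sum.elim b d) (ξhat i) (η i)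
    (by
      rintro (k | j)
      · exact (hη i).1 k
      · exact (hη i).2 j)
    (fun ξ hξ => hηmin i ξ ⟨fun k => hξ (.inl k), fun j => hξ (.inr j)⟩) hlam
  refine le_trans (iInf_le_of_le lam <| iInf_le_of_le s <|
    iInf_le_of_le (fun i j => μ i (.inr j)) <| iInf_le_of_le (fun i k => μ i (.inl k)) <|
    iInf_le_of_le ⟨fun i => ?_, fun i => ?_, fun i j => hμ i _, fun i k => hμ i _, hs⟩
      le_rfl) hval
  · have h1 : lam * nrm (ξhat i - η i) ≤ ∑ k, μ i (.inl k) * (A k ⬝ᵥ ξhat i - b k) +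
        ∑ j, μ i (.inr j) * (C j ⬝ᵥ ξhat i - d j) :=
      (hepi i).trans_eq (Fintype.sum_sum_type _)
    have h2 : (fun k => μ i (.inl k)) ⬝ᵥ (b - A *ᵥ ξhat i) =
        -∑ k, μ i (.inl k) * (A k ⬝ᵥ ξhat i - b k) := by
      rw [dotProduct, ← Finset.sum_neg_distrib]
      refine Finset.sum_congr rfl fun k _ => ?_
      simp only [Pi.sub_apply, mulVec]
      ring
    have h3 : (fun j => μ i (.inr j)) ⬝ᵥ (d - C *ᵥ ξhat i) =
        -∑ j, μ i (.inr j) * (C j ⬝ᵥ ξhat i - d j) := by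
      rw [dotProduct, ← Finset.sum_neg_distrib]
      refine Finset.sum_congr rfl fun j _ => ?_
      simp only [Pi.sub_apply, mulVec]
      ring
    rw [h2, h3]
    linarith [hle i]
  · refine dualNorm_le hlam fun ξ => le_of_eq_of_le ?_ (hslope i ξ)
    simp only [Fintype.sum_sum_type, add_dotProduct, transpose_mulVec_dotProduct]
    rfl

end

end WassersteinUQ

theorem mainTheorem7 {m N J K : ℕ} (hN : 0 < N)
    (nrm : Seminorm ℝ (Fin m → ℝ)) (hnrm : ∀ ξ, nrm ξ = 0 → ξ = 0)
    (C : Matrix (Fin J) (Fin m) ℝ) (d : Fin J → ℝ)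
    (A : Matrix (Fin K) (Fin m) ℝ) (b : Fin K → ℝ)
    (ξhat : Fin N → Fin m → ℝ) (hξhat : ∀ i, ξhat i ∈ closedPolytope C d)
    (ε : ℝ) (hε : 0 ≤ ε) :
    (0 < K →
      (∀ k, ({ξ | b k ≤ A k ⬝ᵥ ξ} ∩ closedPolytope C d).Nonempty) →
      supProb nrm (closedPolytope C d) ξhat ε (openPolytope A b)ᶜ =
        worstValue nrm C d A b ξhat ε) ∧
    ((closedPolytope A b ∩ closedPolytope C d).Nonempty →
      supProb nrm (closedPolytope C d) ξhat ε (closedPolytope A b) =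
        bestValue nrm C d A b ξhat ε) := by
  exact ⟨fun hK hne => le_antisymm (supProb_le_worstValue hN hnrm C d A b ξhat hε hK)
      (worstValue_le_supProb hN hnrm C d A b ξhat hξhat hε hK hne),
    fun hne => le_antisymm (supProb_le_bestValue hN hnrm C d A b ξhat hε)
      (bestValue_le_supProb hN hnrm C d A b ξhat hξhat hε hne)⟩
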